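/- A numerical semigroup is a submonoid $S$ of $(\mathbb{N},+)$ such that $\mathbb{N}\setminus S$ is finite. Let $\operatorname{msg}(S)$ denote the unique minimal system of generators of $S$ (it is finite), and let $\operatorname{e}(S)$ be its cardinality. A numerical semigroup $T$ is a multiple of $S$ if there is an integer $d\ge 1$ with $S=\{x\in\mathbb{N}\mid d\,x\in T\}$. The quotient rank of $S$ is $\min\{\operatorname{e}(T)\mid T \text{ is a numerical semigroup that is a multiple of } S\}$, and $S$ has full quotient rank if its quotient rank equals $\operatorname{e}(S)$. For $n\in S$, where $\operatorname{msg}(S)=\{a_1,\ldots,a_e\}$, let $\nabla_n$ be the graph whose vertices are the factorizations of $n$, that is, the $u\in\mathbb{N}^e$ with $\sum_{i=1}^e u_i a_i=n$, two distinct factorizations $u,v$ being adjacent when $u_i\neq 0\neq v_i$ for some $i$. The element $n\in S$ is a Betti element of $S$ if $\nabla_n$ is not connected. **Corollary.** If $S$ is a numerical semigroup with a unique (that is, exactly one) Betti element, then $S$ has full quotient rank. -/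

import Mathlib

namespace NumSemigroup

/-- A numerical semigroup: a submonoid of `(ℕ, +)` with finite complement in `ℕ`. -/
def IsNumericalSemigroup (S : AddSubmonoid ℕ) : Prop :=
  ((S : Set ℕ)ᶜ).Finite

/-- `A` is a minimal system of generators of `S`: it generates `S`, and no proper subset of `A`
generates `S`. -/
def IsMinimalSystemOfGenerators (S : AddSubmonoid ℕ) (A : Set ℕ) : Prop :=
  AddSubmonoid.closure A = S ∧ ∀ B : Set ℕ, B ⊂ A → AddSubmonoid.closure B ≠ S

/-- The minimal system of generators `msg(S)`: the nonzero elements of `S` that are not a sum of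
two nonzero elements of `S`. By `isMinimalSystemOfGenerators_iff` below, this is the one and only
minimal system of generators of `S`; by `msg_finite` it is finite. -/
def msg (S : AddSubmonoid ℕ) : Set ℕ :=
  {a | a ∈ S ∧ a ≠ 0 ∧ ∀ b ∈ S, ∀ c ∈ S, a = b + c → b = 0 ∨ c = 0}

/-- The embedding dimension `e(S)`: the number of minimal generators. -/
noncomputable def embDim (S : AddSubmonoid ℕ) : ℕ :=
  (msg S).ncard

/-- The quotient `T / d = {x ∈ ℕ | d x ∈ T}`. -/
def quotient (T : AddSubmonoid ℕ) (d : ℕ) : AddSubmonoid ℕ where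
  carrier := {x | d * x ∈ T}
  zero_mem' := by simp
  add_mem' := by
    intro a b ha hb
    simpa [Nat.mul_add] using T.add_mem ha hb

/-- `T` is a multiple of `S`: `T / d = S` for some positive integer `d`. -/
def IsMultiple (T S : AddSubmonoid ℕ) : Prop :=
  ∃ d : ℕ, d ≠ 0 ∧ quotient T d = S

/-- The set of embedding dimensions `e(T)` of the numerical semigroups `T` that are multiples
of `S`. -/
def multipleEmbDims (S : AddSubmonoid ℕ) : Set ℕ :=
  {k | ∃ T : AddSubmonoid ℕ, IsNumericalSemigroup T ∧ IsMultiple T S ∧ embDim T = k}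

/-- The quotient rank `min {e(T) | T is a multiple of S}` of a numerical semigroup `S`
(the minimum exists, see `quotientRank_isLeast`). -/
noncomputable def quotientRank (S : AddSubmonoid ℕ) : ℕ :=
  sInf (multipleEmbDims S)

/-- `S` has full quotient rank: its quotient rank equals its embedding dimension. -/
def HasFullQuotientRank (S : AddSubmonoid ℕ) : Prop :=
  quotientRank S = embDim S

/-- The set `Z(n)` of factorizations of `n` in `S`: the families `u` of natural numbers indexed by
the minimal generators `a` of `S` (finitely many) with `∑ u_a a = n`. -/
def factorizations (S : AddSubmonoid ℕ) (n : ℕ) : Set (msg S →₀ ℕ) :=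
  {u | (u.sum fun a k => k * (a : ℕ)) = n}

/-- The graph `∇_n` of factorizations of `n`: two distinct factorizations are joined by an edge
when some minimal generator occurs in both of them. -/
def factorizationGraph (S : AddSubmonoid ℕ) (n : ℕ) : SimpleGraph (factorizations S n) where
  Adj u v := u ≠ v ∧ ∃ a : msg S, u.1 a ≠ 0 ∧ v.1 a ≠ 0
  symm := ⟨fun _ _ ⟨h, a, hu, hv⟩ => ⟨h.symm, a, hv, hu⟩⟩
  loopless := ⟨fun _ h => h.1 rfl⟩

/-- The Betti elements of `S`: the `n ∈ S` whose graph `∇_n` is not connected. -/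
def bettiElements (S : AddSubmonoid ℕ) : Set ℕ :=
  {n | n ∈ S ∧ ¬ (factorizationGraph S n).Connected}

/-- `S` has a unique Betti element. -/
def HasUniqueBettiElement (S : AddSubmonoid ℕ) : Prop :=
  ∃! n : ℕ, n ∈ bettiElements S

theorem closure_msg (S : AddSubmonoid ℕ) : AddSubmonoid.closure (msg S) = S := by
  apply le_antisymm
  · exact (AddSubmonoid.closure_le).2 fun a ha => ha.1
  · intro n hn
    induction n using Nat.strong_induction_on with
    | _ n ih =>
      by_cases h : n ∈ msg S
      · exact AddSubmonoid.subset_closure h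
      · by_cases h0 : n = 0
        · subst h0; exact zero_mem _
        · simp only [msg, Set.mem_ofPred_eq, not_and, not_forall, not_or] at h
          obtain ⟨b, hb, c, hc, rfl, hb0, hc0⟩ := h hn h0
          exact add_mem (ih b (by omega) hb) (ih c (by omega) hc)

theorem msg_subset_of_closure_eq {S : AddSubmonoid ℕ} {A : Set ℕ}
    (h : AddSubmonoid.closure A = S) : msg S ⊆ A := by
  subst h
  intro a ha
  suffices H : ∀ x ∈ AddSubmonoid.closure A, x ∈ msg (AddSubmonoid.closure A) → x ∈ A from
    H a ha.1 ha
  intro x hx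
  induction hx using AddSubmonoid.closure_induction with
  | mem x hx => exact fun _ => hx
  | zero => exact fun h => absurd rfl h.2.1
  | add x y hx hy ihx ihy =>
    intro h
    rcases h.2.2 x hx y hy rfl with h0 | h0
    · subst h0; rw [zero_add] at h ⊢; exact ihy h
    · subst h0; rw [add_zero] at h ⊢; exact ihx h

theorem isMinimalSystemOfGenerators_iff (S : AddSubmonoid ℕ) (A : Set ℕ) :
    IsMinimalSystemOfGenerators S A ↔ A = msg S := by
  constructor
  · rintro ⟨h1, h2⟩
    by_contra hne
    exact h2 (msg S) ((msg_subset_of_closure_eq h1).ssubset_of_ne (Ne.symm hne)) (closure_msg S)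
  · rintro rfl
    exact ⟨closure_msg S, fun B hB h => hB.2 (msg_subset_of_closure_eq h)⟩

theorem msg_finite (S : AddSubmonoid ℕ) : (msg S).Finite := by
  obtain ⟨A, hA⟩ := Nat.addSubmonoid_fg S
  exact A.finite_toSet.subset (msg_subset_of_closure_eq hA)

theorem quotientRank_isLeast {S : AddSubmonoid ℕ} (hS : IsNumericalSemigroup S) :
    IsLeast (multipleEmbDims S) (quotientRank S) := by
  have hne : (multipleEmbDims S).Nonempty :=
    ⟨embDim S, S, hS, ⟨1, one_ne_zero, by ext x; simp [quotient]⟩, rfl⟩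
  exact ⟨Nat.sInf_mem hne, fun k hk => Nat.sInf_le hk⟩

end NumSemigroup

/-!
Let `S = T / d`. Factorizations in `T` of the multiples `d a`, for `a ∈ msg(S)`, are `e(S)` vectors
in `ℕ ^ e(T)`; if `e(T) < e(S)`, they satisfy an integer relation with coprime coefficients. Let
`P ≠ ∅` be the set of generators whose coefficient is odd. Modulo `2`, the relation says that the
vectors attached to `P` add up to twice a vector of natural numbers and that `∑_{a ∈ P} a = 2 x`
for some `x ∈ ℕ`, whence `d x ∈ T`, that is, `x ∈ S`. Doubling a factorization of `x` gives a
factorization of `∑_{a ∈ P} a` with even coefficients, so the sum of all minimal generators of `S`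
has a second factorization besides the obvious one.

If an element has two factorizations, each of them dominates a factorization `z` of a Betti
element. When `b` is the only Betti element, it is a multiple `k_a a` of every minimal generator
`a`, with `k_a ≥ 2`, and distinct factorizations of `b` have disjoint supports. So `z` consists of
`k_a ≥ 2` copies of a single `a`, and cannot be dominated by the obvious factorization of the sum of
all minimal generators, in which each of them occurs once.
-/

namespace NumSemigroup

theorem embDim_mem_multipleEmbDims {S : AddSubmonoid ℕ} (hS : IsNumericalSemigroup S) :
    embDim S ∈ multipleEmbDims S :=
  ⟨S, hS, ⟨1, one_ne_zero, by ext x; simp [quotient]⟩, rfl⟩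

theorem mem_quotient {T : AddSubmonoid ℕ} {d x : ℕ} : x ∈ quotient T d ↔ d * x ∈ T :=
  Iff.rfl

theorem card_msg (S : AddSubmonoid ℕ) [Fintype (msg S)] : Fintype.card (msg S) = embDim S := by
  rw [← Nat.card_eq_fintype_card, Nat.card_coe_set_eq, embDim]

section Factorizations

variable {S : AddSubmonoid ℕ}

/-- The value `∑ u_a a` of a family of coefficients indexed by the minimal generators, so that
`u ∈ factorizations S n` unfolds to `factorizationValue S u = n`. -/
noncomputable def factorizationValue (S : AddSubmonoid ℕ) : (msg S →₀ ℕ) →ₗ[ℕ] ℕ :=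
  Finsupp.linearCombination ℕ (Subtype.val : msg S → ℕ)

theorem factorizationValue_eq_sum [Fintype (msg S)] (u : msg S →₀ ℕ) :
    factorizationValue S u = ∑ a, u a * (a : ℕ) := by
  simp [factorizationValue, Finsupp.linearCombination_apply, Finsupp.sum_fintype]

theorem factorizationValue_single (a : msg S) (k : ℕ) :
    factorizationValue S (Finsupp.single a k) = k * a := by
  simp [factorizationValue]

theorem factorizationValue_sum_single_one (P : Finset (msg S)) :
    factorizationValue S (∑ a ∈ P, Finsupp.single a 1) = ∑ a ∈ P, (a : ℕ) := by
  simp only [map_sum, factorizationValue_single, one_mul]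

theorem factorizationValue_mono : Monotone (factorizationValue S) := by
  intro u v h
  obtain ⟨w, rfl⟩ := exists_add_of_le h
  rw [map_add]
  exact Nat.le_add_right _ _

theorem mem_iff_exists_factorizationValue_eq {n : ℕ} :
    n ∈ S ↔ ∃ u, factorizationValue S u = n := by
  rw [← LinearMap.mem_range, factorizationValue, Finsupp.range_linearCombination,
    Subtype.range_coe, ← Submodule.mem_toAddSubmonoid,
    Submodule.span_nat_eq_addSubmonoidClosure, closure_msg]

theorem msg_pos (a : msg S) : 0 < (a : ℕ) :=
  Nat.pos_of_ne_zero a.2.2.1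

theorem exists_eq_single_one_add {u : msg S →₀ ℕ} {a : msg S} (ha : u a ≠ 0) :
    ∃ w, u = Finsupp.single a 1 + w :=
  exists_add_of_le (Finsupp.single_le_iff.2 (Nat.one_le_iff_ne_zero.2 ha))

theorem factorizationValue_single_one_add (a : msg S) (w : msg S →₀ ℕ) :
    factorizationValue S (Finsupp.single a 1 + w) = a + factorizationValue S w := by
  rw [map_add, factorizationValue_single, one_mul]

theorem factorizationValue_eq_zero_iff {u : msg S →₀ ℕ} : factorizationValue S u = 0 ↔ u = 0 := by
  refine ⟨fun h => ?_, fun h => by rw [h, map_zero]⟩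
  by_contra hu
  obtain ⟨a, ha⟩ := Finsupp.ne_iff.1 hu
  obtain ⟨w, rfl⟩ := exists_eq_single_one_add ha
  rw [factorizationValue_single_one_add] at h
  have := msg_pos a
  omega

theorem eq_single_one_of_factorizationValue_eq {u : msg S →₀ ℕ} {a : msg S}
    (h : factorizationValue S u = a) : u = Finsupp.single a 1 := by
  have hu : u ≠ 0 := by
    rintro rfl
    exact (msg_pos a).ne ((map_zero _).symm.trans h)
  obtain ⟨c, hc⟩ := Finsupp.ne_iff.1 hu
  obtain ⟨w, rfl⟩ := exists_eq_single_one_add hc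
  rw [factorizationValue_single_one_add] at h
  have hw : factorizationValue S w = 0 :=
    (a.2.2.2 _ c.2.1 _ (mem_iff_exists_factorizationValue_eq.2 ⟨w, rfl⟩) h.symm).resolve_left
      (msg_pos c).ne'
  rw [hw, add_zero] at h
  rw [factorizationValue_eq_zero_iff.1 hw, add_zero, Subtype.ext h]

end Factorizations

section BettiElements

variable {S : AddSubmonoid ℕ}

theorem exists_ne_of_factorizationValue_mem_bettiElements {u : msg S →₀ ℕ}
    (hu : factorizationValue S u ∈ bettiElements S) :
    ∃ v ≠ u, factorizationValue S v = factorizationValue S u := by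
  by_contra! hunique
  have : Unique (factorizations S (factorizationValue S u)) :=
    { default := ⟨u, rfl⟩
      uniq := fun v => Subtype.ext (not_imp_not.1 (hunique v.1) v.2) }
  exact hu.2 { preconnected := SimpleGraph.Preconnected.of_subsingleton }

theorem zero_notMem_bettiElements : 0 ∉ bettiElements S := by
  intro h
  rw [← map_zero (factorizationValue S)] at h
  obtain ⟨v, hv, hval⟩ := exists_ne_of_factorizationValue_mem_bettiElements h
  exact hv (factorizationValue_eq_zero_iff.1 (hval.trans (map_zero _)))

theorem msg_notMem_bettiElements (a : msg S) : (a : ℕ) ∉ bettiElements S := by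
  intro h
  have hval : factorizationValue S (Finsupp.single a 1) = a := by
    rw [factorizationValue_single, one_mul]
  rw [← hval] at h
  obtain ⟨v, hv, hva⟩ := exists_ne_of_factorizationValue_mem_bettiElements h
  exact hv (eq_single_one_of_factorizationValue_eq (hva.trans hval))

theorem exists_le_factorizationValue_mem_bettiElements {u v : msg S →₀ ℕ}
    (huv : factorizationValue S u = factorizationValue S v) (hne : u ≠ v) :
    ∃ z ≤ u, factorizationValue S z ∈ bettiElements S := by
  induction hn : factorizationValue S u using Nat.strong_induction_on generalizing u v with
  | _ n ih =>
    by_cases hbetti : n ∈ bettiElements S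
    · exact ⟨u, le_rfl, hn ▸ hbetti⟩
    have hconn : (factorizationGraph S n).Connected := by
      by_contra hconn
      exact hbetti ⟨mem_iff_exists_factorizationValue_eq.2 ⟨u, hn⟩, hconn⟩
    have : Nontrivial (factorizations S n) :=
      ⟨⟨u, hn⟩, ⟨v, huv.symm.trans hn⟩, fun h => hne (congrArg Subtype.val h)⟩
    obtain ⟨⟨w, hw⟩, huw, a, hua, hwa⟩ := hconn.preconnected.exists_adj_of_nontrivial ⟨u, hn⟩
    obtain ⟨u', rfl⟩ := exists_eq_single_one_add hua
    obtain ⟨w', rfl⟩ := exists_eq_single_one_add hwa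
    change factorizationValue S _ = n at hw
    rw [factorizationValue_single_one_add] at hn hw
    have ha := msg_pos a
    obtain ⟨z, hz, hzb⟩ := ih (factorizationValue S u') (by omega) (v := w') (by omega)
      (fun h => huw (by simp only [h])) rfl
    exact ⟨z, hz.trans le_add_self, hzb⟩

theorem eq_of_mem_lowerBounds_bettiElements {u v : msg S →₀ ℕ}
    (hmin : factorizationValue S u ∈ lowerBounds (bettiElements S))
    (huv : factorizationValue S u = factorizationValue S v) {a : msg S}
    (hua : u a ≠ 0) (hva : v a ≠ 0) : u = v := by
  obtain ⟨u', rfl⟩ := exists_eq_single_one_add hua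
  obtain ⟨v', rfl⟩ := exists_eq_single_one_add hva
  rw [factorizationValue_single_one_add] at huv hmin
  rw [factorizationValue_single_one_add] at huv
  by_contra hne
  obtain ⟨z, hz, hzb⟩ := exists_le_factorizationValue_mem_bettiElements
    (Nat.add_left_cancel huv) (fun h => hne (by rw [h]))
  have hle := (hmin hzb).trans (factorizationValue_mono hz)
  have := msg_pos a
  omega

theorem exists_mul_mem_bettiElements {a c : msg S} (hac : a ≠ c) :
    ∃ k : ℕ, k * a ∈ bettiElements S := by
  have hval : factorizationValue S (Finsupp.single a (c : ℕ))
      = factorizationValue S (Finsupp.single c (a : ℕ)) := by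
    rw [factorizationValue_single, factorizationValue_single, mul_comm]
  have hne : Finsupp.single a (c : ℕ) ≠ Finsupp.single c (a : ℕ) := by
    simp [Finsupp.single_eq_single_iff, hac, (msg_pos c).ne']
  obtain ⟨z, hz, hzb⟩ := exists_le_factorizationValue_mem_bettiElements hval hne
  have hsupp : z = Finsupp.single a (z a) :=
    Finsupp.support_subset_singleton.1
      ((Finsupp.support_mono hz).trans Finsupp.support_single_subset)
  rw [hsupp, factorizationValue_single] at hzb
  exact ⟨z a, hzb⟩

theorem apply_ne_one_of_subsingleton_bettiElements (hB : (bettiElements S).Subsingleton)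
    {z : msg S →₀ ℕ} (hz : factorizationValue S z ∈ bettiElements S) (a : msg S) : z a ≠ 1 := by
  intro hza
  have hza0 : z a ≠ 0 := hza ▸ one_ne_zero
  have hmin : factorizationValue S z ∈ lowerBounds (bettiElements S) :=
    fun n hn => (hB hz hn).le
  obtain ⟨w, hwz, hval⟩ := exists_ne_of_factorizationValue_mem_bettiElements hz
  have hw : w ≠ 0 := by
    rintro rfl
    rw [← hval, map_zero] at hz
    exact zero_notMem_bettiElements hz
  obtain ⟨c, hwc⟩ := Finsupp.ne_iff.1 hw
  have hac : a ≠ c := by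
    rintro rfl
    exact hwz (eq_of_mem_lowerBounds_bettiElements hmin hval.symm hza0 hwc).symm
  obtain ⟨k, hk⟩ := exists_mul_mem_bettiElements hac
  have hk0 : k ≠ 0 := by
    rintro rfl
    exact zero_notMem_bettiElements (zero_mul (a : ℕ) ▸ hk)
  have hzk : z = Finsupp.single a k :=
    eq_of_mem_lowerBounds_bettiElements hmin
      ((hB hz hk).trans (factorizationValue_single a k).symm) hza0 (by rwa [Finsupp.single_eq_same])
  rw [hzk, Finsupp.single_eq_same] at hza
  rw [hza, one_mul] at hk
  exact msg_notMem_bettiElements a hk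

theorem subsingleton_factorizations_sum_msg (hB : (bettiElements S).Subsingleton) :
    (factorizations S (∑ᶠ a : msg S, (a : ℕ))).Subsingleton := by
  have : Fintype (msg S) := (msg_finite S).fintype
  suffices h : ∀ v, factorizationValue S (∑ a, Finsupp.single a 1) = factorizationValue S v →
      ∑ a, Finsupp.single a 1 = v by
    rw [finsum_eq_sum_of_fintype, ← factorizationValue_sum_single_one]
    exact fun u hu v hv => (h u hu.symm).symm.trans (h v hv.symm)
  intro v hv
  by_contra hne
  obtain ⟨z, hz, hzb⟩ := exists_le_factorizationValue_mem_bettiElements hv hne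
  have hz0 : z ≠ 0 := by
    rintro rfl
    exact zero_notMem_bettiElements (map_zero (factorizationValue S) ▸ hzb)
  obtain ⟨a, ha⟩ := Finsupp.ne_iff.1 hz0
  have hza : z a ≤ 1 := by
    simpa [Finsupp.finsetSum_apply, Finsupp.single_apply] using hz a
  exact apply_ne_one_of_subsingleton_bettiElements hB hzb a
    (le_antisymm hza (Nat.one_le_iff_ne_zero.2 ha))

end BettiElements

section Quotients

theorem exists_relation_not_dvd {ι R M : Type*} [Fintype ι] [CommRing R] [NormalizedGCDMonoid R]
    [AddCommGroup M] [Module R M] [Module.IsTorsionFree R M]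
    {V : ι → M} (hV : ¬ LinearIndependent R V) {p : R} (hp : ¬ IsUnit p) :
    ∃ γ : ι → R, ∑ i, γ i • V i = 0 ∧ ∃ i, ¬ p ∣ γ i := by
  obtain ⟨f, hf, j, hj⟩ := Fintype.not_linearIndependent_iff.1 hV
  obtain ⟨γ, hγ, hgcd⟩ := Finset.extract_gcd f ⟨j, Finset.mem_univ j⟩
  have hD : Finset.univ.gcd f ≠ 0 := fun hD =>
    hj (Finset.gcd_eq_zero_iff.1 hD j (Finset.mem_univ j))
  refine ⟨γ, ?_, ?_⟩
  · refine (smul_eq_zero.1 (?_ : Finset.univ.gcd f • ∑ i, γ i • V i = 0)).resolve_left hD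
    simp_rw [Finset.smul_sum, smul_smul, ← hγ _ (Finset.mem_univ _), hf]
  · by_contra! hdvd
    exact hp (isUnit_of_dvd_one (hgcd ▸ Finset.dvd_gcd fun i _ => hdvd i))

theorem even_sum_filter_odd {ι : Type*} {s : Finset ι} {γ : ι → ℤ} {n : ι → ℕ}
    (h : ∑ i ∈ s, γ i * n i = 0) : Even (∑ i ∈ s with Odd (γ i), n i) := by
  have hmod : ((∑ i ∈ s with Odd (γ i), n i : ℕ) : ZMod 2) =
      ((∑ i ∈ s, γ i * n i : ℤ) : ZMod 2) := by
    push_cast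
    rw [Finset.sum_filter]
    refine Finset.sum_congr rfl fun i _ => ?_
    split_ifs with hodd
    · rw [ZMod.intCast_eq_one_iff_odd.2 hodd, one_mul]
    · rw [ZMod.intCast_eq_zero_iff_even.2 (Int.not_odd_iff_even.1 hodd), zero_mul]
  rw [h, Int.cast_zero] at hmod
  exact ZMod.natCast_eq_zero_iff_even.1 hmod

theorem sum_mul_factorizationValue_eq_zero {S : AddSubmonoid ℕ} {ι : Type*} [Fintype ι]
    {γ : ι → ℤ} {V : ι → msg S →₀ ℕ} (hγ : ∀ a, ∑ i, γ i * V i a = 0) :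
    ∑ i, γ i * factorizationValue S (V i) = 0 := by
  have : Fintype (msg S) := (msg_finite S).fintype
  calc ∑ i, γ i * factorizationValue S (V i)
      = ∑ i, ∑ a : msg S, γ i * V i a * (a : ℕ) := by
        simp only [factorizationValue_eq_sum, Nat.cast_sum, Nat.cast_mul, Finset.mul_sum, mul_assoc]
    _ = ∑ a : msg S, (∑ i, γ i * V i a) * (a : ℕ) := by
        rw [Finset.sum_comm]
        simp only [Finset.sum_mul]
    _ = 0 := by simp only [hγ, zero_mul, Finset.sum_const_zero]

theorem exists_sum_eq_two_mul_of_embDim_lt {T : AddSubmonoid ℕ} {d : ℕ} (hd : d ≠ 0)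
    {ι : Type*} [Fintype ι] {s : ι → ℕ} (hs : ∀ i, s i ∈ quotient T d)
    (hcard : embDim T < Fintype.card ι) :
    ∃ P : Finset ι, P.Nonempty ∧ ∃ x ∈ quotient T d, ∑ i ∈ P, s i = 2 * x := by
  have : Fintype (msg T) := (msg_finite T).fintype
  choose V hV using fun i => mem_iff_exists_factorizationValue_eq.1 (mem_quotient.1 (hs i))
  have hdep : ¬ LinearIndependent ℤ fun i (t : msg T) => (V i t : ℤ) := fun hind => by
    have hle := hind.fintype_card_le_finrank
    rw [Module.finrank_fintype_fun_eq_card, card_msg] at hle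
    omega
  obtain ⟨γ, hγ, j, hj⟩ := exists_relation_not_dvd hdep Int.prime_two.not_isUnit
  have hγV : ∀ t, ∑ i, γ i * V i t = 0 := fun t => by simpa using congrFun hγ t
  have hγs : ∑ i, γ i * s i = 0 := by
    have h := sum_mul_factorizationValue_eq_zero hγV
    simp only [hV, Nat.cast_mul, mul_left_comm _ (d : ℤ), ← Finset.mul_sum] at h
    exact (mul_eq_zero.1 h).resolve_left (Nat.cast_ne_zero.2 hd)
  choose W hW using fun t => even_iff_exists_two_mul.1 (even_sum_filter_odd (hγV t))
  obtain ⟨x, hx⟩ := even_iff_exists_two_mul.1 (even_sum_filter_odd hγs)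
  have hVW : ∑ i with Odd (γ i), V i = 2 • Finsupp.equivFunOnFinite.symm W := by
    ext t
    rw [Finsupp.finsetSum_apply]
    exact hW t
  refine ⟨_, ⟨j, ?_⟩, x, mem_quotient.2 (mem_iff_exists_factorizationValue_eq.2
    ⟨Finsupp.equivFunOnFinite.symm W, ?_⟩), hx⟩
  · exact Finset.mem_filter.2 ⟨Finset.mem_univ j,
      Int.not_even_iff_odd.1 fun h => hj (even_iff_two_dvd.1 h)⟩
  · refine Nat.eq_of_mul_eq_mul_left two_pos ?_
    calc 2 * factorizationValue T (Finsupp.equivFunOnFinite.symm W)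
        = factorizationValue T (∑ i with Odd (γ i), V i) := by rw [hVW, map_nsmul, smul_eq_mul]
      _ = d * ∑ i with Odd (γ i), s i := by rw [map_sum, Finset.mul_sum]; simp only [hV]
      _ = 2 * (d * x) := by rw [hx, mul_left_comm]

theorem embDim_le_of_isMultiple {S T : AddSubmonoid ℕ}
    (hS : (factorizations S (∑ᶠ a : msg S, (a : ℕ))).Subsingleton) (hT : IsMultiple T S) :
    embDim S ≤ embDim T := by
  obtain ⟨d, hd, rfl⟩ := hT
  have : Fintype (msg (quotient T d)) := (msg_finite _).fintype
  by_contra! hlt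
  obtain ⟨P, ⟨a, ha⟩, x, hx, hPx⟩ := exists_sum_eq_two_mul_of_embDim_lt hd
    (s := fun c : msg (quotient T d) => (c : ℕ)) (fun c => c.2.1) (by rwa [card_msg (quotient T d)])
  obtain ⟨u, hu⟩ := mem_iff_exists_factorizationValue_eq.1 hx
  have hval : factorizationValue _ (2 • u + ∑ c ∈ Pᶜ, Finsupp.single c 1) =
      ∑ᶠ c : msg (quotient T d), (c : ℕ) := by
    rw [map_add, map_nsmul, hu, factorizationValue_sum_single_one, smul_eq_mul, ← hPx,
      Finset.sum_add_sum_compl, finsum_eq_sum_of_fintype]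
  have hone : factorizationValue _ (∑ c : msg (quotient T d), Finsupp.single c 1) =
      ∑ᶠ c : msg (quotient T d), (c : ℕ) := by
    rw [factorizationValue_sum_single_one, finsum_eq_sum_of_fintype]
  have hua : 2 * u a = 1 := by
    simpa [Finsupp.finsetSum_apply, Finsupp.single_apply, ha] using
      DFunLike.congr_fun (hS hval hone) a
  omega

end Quotients

end NumSemigroup

theorem mainTheorem4_general (S : AddSubmonoid ℕ) (hS : NumSemigroup.IsNumericalSemigroup S)
    (hsum : (NumSemigroup.factorizations S (∑ᶠ a : NumSemigroup.msg S, (a : ℕ))).Subsingleton) :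
    NumSemigroup.HasFullQuotientRank S := by
  refine (NumSemigroup.quotientRank_isLeast hS).unique
    ⟨NumSemigroup.embDim_mem_multipleEmbDims hS, ?_⟩
  rintro _ ⟨T, -, hT, rfl⟩
  exact NumSemigroup.embDim_le_of_isMultiple hsum hT

theorem mainTheorem4 (S : AddSubmonoid ℕ) (hS : NumSemigroup.IsNumericalSemigroup S)
    (hB : NumSemigroup.HasUniqueBettiElement S) : NumSemigroup.HasFullQuotientRank S :=
  mainTheorem4_general S hS
    (NumSemigroup.subsingleton_factorizations_sum_msg fun _ hm _ hn => hB.unique hm hn)
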